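/- Let $V$ be a real locally convex vector space whose topology is generated by a family of seminorms $(\xi_i)_{i\in I}$, and let the tensor powers $V^{\otimes n}$ be equipped with a symmetric system of cross seminorms $\xi_{i_1}\otimes\cdots\otimes\xi_{i_n}$, that is, $$(\xi_{i_1}\otimes\cdots\otimes\xi_{i_{m+n}})(a\otimes b)=(\xi_{i_1}\otimes\cdots\otimes\xi_{i_m})(a)\,(\xi_{i_{m+1}}\otimes\cdots\otimes\xi_{i_{m+n}})(b)$$ and $(\xi_{i_1}\otimes\cdots\otimes\xi_{i_n})(a)=(\xi_{i_{\sigma(1)}}\otimes\cdots\otimes\xi_{i_{\sigma(n)}})(\sigma a)$ for all permutations $\sigma$, where $\sigma(v_1\otimes\cdots\otimes v_n)=v_{\sigma(1)}\otimes\cdots\otimes v_{\sigma(n)}$ (on $V^{\otimes 0}=\mathbb R$ the seminorm is the absolute value, on $V^{\otimes 1}=V$ it is $\xi_i$). Let $V^{\hat\otimes n}$ be the Hausdorff completion of $V^{\otimes n}$. A (non-planar rooted) tree is an isomorphism class of finite posets with a unique minimal element (the root) in which every set $\{w: w\prec v\}$ is totally ordered. For a tree $\tau$ with $|\tau|$ non-root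 vertices, which are enumerated, let $SG(\tau)\subset\mathfrak S_{|\tau|}$ be its group of order automorphisms and $$V^{\hat\otimes\tau}:=V^{\hat\otimes|\tau|}/\ker(\mathrm{sym}_{SG(\tau)}),\qquad \mathrm{sym}_G=\frac1{|G|}\sum_{\sigma\in G}\sigma .$$ Let $\mathbf 1$ be the tree with only a root, let $V^{\hat\otimes\mathbf 1}=\mathbb R$, and let $\widehat{\mathcal H}_{GL}(V)=\prod_\tau V^{\hat\otimes\tau}$, with the product topology. Let $\circ$ be the continuous bilinear product on it that joins two labelled trees at their roots (its unit is $1\in V^{\hat\otimes\mathbf 1}$), let $\pi_1$ be the projection onto the trees whose root has exactly one child, and let $\Delta_{GL}$ be the continuous linear map with $$\Delta_{GL}(\mathbf t_1\circ\cdots\circ\mathbf t_k)=\sum_{J\subset\{1,\dots,k\}}\Big(\mathop{\bigcirc}_{i\in J}\mathbf t_i\Big)\otimes\Big(\mathop{\bigcirc}_{i\notin J}\mathbf t_i\Big)$$ for labelled trees $\mathbf t_1,\dots,\mathbf t_k$ whose roots have exactly one child; it takes values in the completed tensor product $\prod_{\tau,\sigma}V^{\hat\otimes\tau}\hat\otimes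 V^{\hat\otimes\sigma}$, where $V^{\hat\otimes\tau}\hat\otimes V^{\hat\otimes\sigma}=V^{\hat\otimes(|\tau|+|\sigma|)}/\ker(\mathrm{sym}_{SG(\tau)\times SG(\sigma)})$. Let $\mathbf t\in\widehat{\mathcal H}_{GL}(V)$ be group-like, i.e. $\mathbf t\ne 0$ and $\Delta_{GL}(\mathbf t)=\mathbf t\otimes\mathbf t$. Then $$\mathbf t=\exp_\circ(\pi_1(\mathbf t)):=\sum_{k=0}^\infty\frac{(\pi_1(\mathbf t))^{\circ k}}{k!},$$ where the series converges (unconditionally) in the product topology. -/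

import Mathlib

open scoped TensorProduct

noncomputable section

namespace LabelledTrees

/-! ### Non-planar rooted trees -/

/-- A (finite) partially ordered set is a rooted tree if it has a unique minimal element (the root)
and, for every vertex `v`, the set of all `w ≺ v` is totally ordered. -/
def IsRootedTree (S : Type*) [PartialOrder S] : Prop :=
  (∃! r : S, IsMin r) ∧ ∀ v : S, IsChain (· ≤ ·) (Set.Iio v)

/-- Every rooted tree is of the form `WithBot X`: the root is `⊥`, and `X` is the poset of the
vertices other than the root. `IsVertexPoset X` says that `WithBot X` is a rooted tree. -/
class IsVertexPoset (X : Type*) [PartialOrder X] : Prop where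
  isRootedTree : IsRootedTree (WithBot X)

theorem isVertexPoset_iff (X : Type*) [PartialOrder X] :
    IsVertexPoset X ↔ ∀ v : X, IsChain (· ≤ ·) (Set.Iio v) := by
  constructor
  · rintro ⟨-, h⟩ v a ha b hb hab
    have := h (v : WithBot X) (x := (a : WithBot X)) (by simpa using ha) (y := (b : WithBot X))
      (by simpa using hb) (by simpa using hab)
    simpa using this
  · refine fun h => ⟨⟨⊥, isMin_bot, fun y hy => hy.eq_bot⟩, ?_⟩
    intro v a ha b hb hab
    induction a using WithBot.recBotCoe with
    | bot => exact Or.inl bot_le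
    | coe a =>
      induction b using WithBot.recBotCoe with
      | bot => exact Or.inr bot_le
      | coe b =>
        induction v using WithBot.recBotCoe with
        | bot => exact absurd ha (by simp)
        | coe v =>
          have := h v (x := a) (by simpa using ha) (y := b) (by simpa using hb)
            (by simpa using hab)
          simpa using this

theorem isVertexPoset_of_orderEmbedding {X Y : Type*} [PartialOrder X] [PartialOrder Y]
    [hY : IsVertexPoset Y] (f : X ↪o Y) : IsVertexPoset X := by
  rw [isVertexPoset_iff] at hY ⊢
  intro v a ha b hb hab
  have := hY (f v) (x := f a) (by simpa using ha) (y := f b) (by simpa using hb)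
    (by simpa using hab)
  simpa using this

instance {X : Type*} [PartialOrder X] [IsVertexPoset X] (p : X → Prop) :
    IsVertexPoset {v : X // p v} :=
  isVertexPoset_of_orderEmbedding (OrderEmbedding.subtype p)

/-- The disjoint union of the non-root vertices of two trees (no relations between the two
parts): adjoining one common root below everything identifies the two roots. -/
instance {X Y : Type*} [PartialOrder X] [PartialOrder Y] [hX : IsVertexPoset X]
    [hY : IsVertexPoset Y] : IsVertexPoset (X ⊕ Y) := by
  rw [isVertexPoset_iff] at hX hY ⊢
  rintro (v | v) (a | a) ha (b | b) hb hab <;> simp at ha hb hab ⊢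
  · exact hX v ha hb (by simpa using hab)
  · exact hY v ha hb (by simpa using hab)

/-- A rooted tree of degree `n` together with an enumeration of its non-root vertices: a tree
order on `WithBot (Fin n)`. -/
structure EnumTree (n : ℕ) where
  order : PartialOrder (Fin n)
  isVertexPoset : @IsVertexPoset (Fin n) order

namespace EnumTree

variable {n : ℕ}

/-- The non-root vertices `v(t)`, already enumerated, with their tree order. -/
def Vert (_t : EnumTree n) : Type := Fin n

instance (t : EnumTree n) : PartialOrder t.Vert := t.order
instance (t : EnumTree n) : IsVertexPoset t.Vert := t.isVertexPoset
instance (t : EnumTree n) : Fintype t.Vert := inferInstanceAs (Fintype (Fin n))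
instance (t : EnumTree n) : DecidableEq t.Vert := inferInstanceAs (DecidableEq (Fin n))

/-- The enumeration of the non-root vertices. -/
def enum (t : EnumTree n) : Fin n ≃ t.Vert := Equiv.refl (Fin n)

/-- Two trees are equivalent if there is an order isomorphism between them. -/
instance setoid (n : ℕ) : Setoid (EnumTree n) where
  r t s := Nonempty (WithBot t.Vert ≃o WithBot s.Vert)
  iseqv := ⟨fun _ => ⟨OrderIso.refl _⟩, fun ⟨e⟩ => ⟨e.symm⟩, fun ⟨e⟩ ⟨f⟩ => ⟨e.trans f⟩⟩

instance : Finite (EnumTree n) := by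
  refine Finite.of_injective (fun t : EnumTree n => t.order.le) ?_
  rintro ⟨o, h⟩ ⟨o', h'⟩ hoo
  obtain rfl : o = o' := PartialOrder.ext fun x y => iff_of_eq (congrFun (congrFun hoo x) y)
  rfl

/-- The children of the root: the vertices covering `⊥`. -/
def rootChildren (t : EnumTree n) : Finset t.Vert :=
  open Classical in Finset.univ.filter fun w => (⊥ : WithBot t.Vert) ⋖ (w : WithBot t.Vert)

/-- The symmetry group of `t`, embedded into the symmetric group by the enumeration. -/
def SG (t : EnumTree n) : Subgroup (Equiv.Perm (Fin n)) where
  carrier := {σ | ∀ v w, t.order.le (σ v) (σ w) ↔ t.order.le v w}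
  mul_mem' := fun {σ τ} hσ hτ v w => (hσ (τ v) (τ w)).trans (hτ v w)
  one_mem' := fun _ _ => Iff.rfl
  inv_mem' := fun {σ} hσ v w => by
    have := hσ (σ⁻¹ v) (σ⁻¹ w)
    simpa using this.symm

end EnumTree

/-- The set of (non-planar rooted) trees of degree `n`. -/
def TreeClass (n : ℕ) : Type := Quotient (EnumTree.setoid n)

instance (n : ℕ) : Finite (TreeClass n) := inferInstanceAs (Finite (Quotient (EnumTree.setoid n)))
instance (n : ℕ) : Fintype (TreeClass n) := Fintype.ofFinite _

/-- The set of all (non-planar rooted) trees; the first component is the degree. -/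
abbrev Tr : Type := Σ n : ℕ, TreeClass n

instance : DecidableEq Tr := Classical.decEq _

/-- The chosen enumerated representative of a tree. -/
def Tr.rep (τ : Tr) : EnumTree τ.1 := Quotient.out (s := EnumTree.setoid τ.1) τ.2

/-- The enumerated tree obtained from a finite vertex poset by some enumeration. -/
def EnumTree.ofPoset (X : Type) [Fintype X] [PartialOrder X] [IsVertexPoset X] :
    EnumTree (Fintype.card X) where
  order := PartialOrder.lift (Fintype.equivFin X).symm (Fintype.equivFin X).symm.injective
  isVertexPoset :=
    letI := PartialOrder.lift (Fintype.equivFin X).symm (Fintype.equivFin X).symm.injective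
    isVertexPoset_of_orderEmbedding ⟨(Fintype.equivFin X).symm.toEmbedding, Iff.rfl⟩

/-- The tree (equivalence class) with non-root vertices `X`. -/
def treeOf (X : Type) [Fintype X] [PartialOrder X] [IsVertexPoset X] : Tr :=
  ⟨Fintype.card X, Quotient.mk _ (EnumTree.ofPoset X)⟩

theorem nonempty_iso_rep (X : Type) [Fintype X] [PartialOrder X] [IsVertexPoset X] :
    Nonempty ((treeOf X).rep.Vert ≃o X) := by
  have h : Nonempty (WithBot (treeOf X).rep.Vert ≃o WithBot (EnumTree.ofPoset X).Vert) :=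
    Quotient.exact (s := EnumTree.setoid (Fintype.card X)) (Quotient.out_eq (s := EnumTree.setoid (Fintype.card X)) _)
  obtain ⟨e⟩ := h
  have key : ∀ {A B : Type} [PartialOrder A] [PartialOrder B],
      (WithBot A ≃o WithBot B) → Nonempty (A ≃o B) := by
    intro A B _ _ e
    refine ⟨⟨⟨fun a => (e a).unbot (by simp), fun b => (e.symm b).unbot (by simp),
      fun a => by simp, fun b => by simp⟩, ?_⟩⟩
    intro a b
    rw [← WithBot.coe_le_coe]
    simp
  obtain ⟨f⟩ := key e
  exact ⟨f.trans ⟨(Fintype.equivFin X).symm, Iff.rfl⟩⟩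

/-- The enumeration of a finite vertex poset `X`; it is compatible with the enumeration of the
chosen representative of its class. -/
def enumOf (X : Type) [Fintype X] [PartialOrder X] [IsVertexPoset X] :
    Fin (treeOf X).1 ≃ X :=
  (treeOf X).rep.enum.trans (Classical.choice (nonempty_iso_rep X)).toEquiv

/-- The tree `𝟏` of degree `0`. -/
def Tr.one : Tr :=
  ⟨0, Quotient.mk _ ⟨inferInstance, (isVertexPoset_iff _).2 fun v => v.elim0⟩⟩

/-- The tree `τ ∘ σ`, obtained by identifying the roots of `τ` and `σ`. -/
def Tr.circ (τ σ : Tr) : Tr := treeOf (τ.rep.Vert ⊕ σ.rep.Vert)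

/-- The number of children of the root. -/
def Tr.numRootChildren (τ : Tr) : ℕ := τ.rep.rootChildren.card

/-- For a set `I` of children of the root: the vertex `v` lies above an element of `I`.
If `t = t₁ ∘ ⋯ ∘ t_k` is the decomposition of `t` into trees whose root has exactly one child,
these are the non-root vertices of `∘_{i ∈ I} t_i`, and the others are those of
`∘_{i ∉ I} t_i`. -/
def EnumTree.InBranches {n : ℕ} (t : EnumTree n) (I : Finset t.Vert) (v : t.Vert) : Prop :=
  ∃ c ∈ I, c ≤ v

instance {n : ℕ} (t : EnumTree n) (I : Finset t.Vert) : DecidablePred (t.InBranches I) :=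
  Classical.decPred _

/-- The tree `∘_{i ∈ I} t_i`. -/
def EnumTree.branches {n : ℕ} (t : EnumTree n) (I : Finset t.Vert) : Tr :=
  treeOf {v : t.Vert // t.InBranches I v}

/-- The tree `∘_{i ∉ I} t_i`. -/
def EnumTree.coBranches {n : ℕ} (t : EnumTree n) (I : Finset t.Vert) : Tr :=
  treeOf {v : t.Vert // ¬ t.InBranches I v}

/-! ### Topological tensor powers -/

/-- A family `ξ` of seminorms generating the topology of `V`, with a symmetric system of cross
seminorms `p n i = ξ_{i 0} ⊗ ⋯ ⊗ ξ_{i (n-1)}` on the tensor powers `V^{⊗ n}`. -/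
structure SymmetricCrossSystem (V : Type*) [AddCommGroup V] [Module ℝ V] [TopologicalSpace V]
    (ι : Type*) where
  /-- the generating family of seminorms -/
  ξ : ι → Seminorm ℝ V
  generates : WithSeminorms ξ
  /-- the seminorms on the tensor powers -/
  p : (n : ℕ) → (Fin n → ι) → Seminorm ℝ (⨂[ℝ]^n V)
  /-- on `V^{⊗ 0} = ℝ` the seminorm is the absolute value -/
  p_zero : ∀ (i : Fin 0 → ι) (c : ℝ) (v : Fin 0 → V), p 0 i (c • PiTensorProduct.tprod ℝ v) = |c|
  p_one : ∀ (i : Fin 1 → ι) (v : Fin 1 → V), p 1 i (PiTensorProduct.tprod ℝ v) = ξ (i 0) (v 0)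
  /-- the cross property -/
  cross : ∀ (m n : ℕ) (i : Fin m → ι) (j : Fin n → ι) (a : ⨂[ℝ]^m V) (b : ⨂[ℝ]^n V),
    p (m + n) (Fin.append i j) (TensorPower.mulEquiv (a ⊗ₜ[ℝ] b)) = p m i a * p n j b
  /-- symmetry; a permutation acts by `σ (v₁ ⊗ ⋯ ⊗ vₙ) = v_{σ 1} ⊗ ⋯ ⊗ v_{σ n}` -/
  symmetric : ∀ (n : ℕ) (i : Fin n → ι) (σ : Equiv.Perm (Fin n)) (a : ⨂[ℝ]^n V),
    p n i a = p n (i ∘ σ) (PiTensorProduct.reindex ℝ (fun _ => V) σ.symm a)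

section Construction

variable {V : Type*} [AddCommGroup V] [Module ℝ V] [TopologicalSpace V] {ι : Type*}
  (S : SymmetricCrossSystem V ι)

/-- `V^{⊗ n}` with the locally convex topology given by the cross seminorms. -/
def TPower (_S : SymmetricCrossSystem V ι) (n : ℕ) : Type _ := ⨂[ℝ]^n V

instance (n : ℕ) : AddCommGroup (TPower S n) := inferInstanceAs (AddCommGroup (⨂[ℝ]^n V))
instance (n : ℕ) : Module ℝ (TPower S n) := inferInstanceAs (Module ℝ (⨂[ℝ]^n V))

/-- The cross seminorms, as seminorms on `TPower S n`. -/
def TPower.seminorm (n : ℕ) (i : Fin n → ι) : Seminorm ℝ (TPower S n) := S.p n i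

instance (n : ℕ) : UniformSpace (TPower S n) :=
  ⨅ i : Fin n → ι, (TPower.seminorm S n i).toSeminormedAddCommGroup.toUniformSpace

instance (n : ℕ) : IsUniformAddGroup (TPower S n) :=
  isUniformAddGroup_iInf fun _ => inferInstance

theorem TPower.withSeminorms (n : ℕ) : WithSeminorms (TPower.seminorm S n) :=
  (SeminormFamily.withSeminorms_iff_uniformSpace_eq_iInf _).2 rfl

instance (n : ℕ) : UniformContinuousConstSMul ℝ (TPower S n) := by
  have := (TPower.withSeminorms S n).continuousSMul
  exact uniformContinuousConstSMul_of_continuousConstSMul _ _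

/-- The completed tensor power `V^{⊗̂ n}` (the Hausdorff completion). -/
abbrev HatPower (n : ℕ) : Type _ := UniformSpace.Completion (TPower S n)

/-- The canonical map `V^{⊗ n} → V^{⊗̂ n}`. -/
def TPower.toHat (n : ℕ) (a : ⨂[ℝ]^n V) : HatPower S n :=
  UniformSpace.Completion.coe' (α := TPower S n) a

/-- For a bijection `e`, the map `v₁ ⊗ ⋯ ⊗ vₙ ↦ v_{e 1} ⊗ ⋯ ⊗ v_{e k}` (where `k = n`). -/
def relabelL {n k : ℕ} (e : Fin k ≃ Fin n) : TPower S n →L[ℝ] TPower S k where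
  toLinearMap := (PiTensorProduct.reindex ℝ (fun _ : Fin n => V) e.symm).toLinearMap
  cont := by
    obtain rfl : k = n := by simpa using Fintype.card_congr e
    refine (TPower.withSeminorms S k).continuous_of_isBounded
      (TPower.withSeminorms S k) _ fun i => ⟨{i ∘ e.symm}, 1, fun a => ?_⟩
    have h := S.symmetric k (i ∘ e.symm) e a
    simp only [Function.comp_assoc, Equiv.symm_comp_self, Function.comp_id] at h
    rw [Finset.sup_singleton, one_smul]
    exact h.symm.le

/-- The continuous extension of `relabelL` to the completed tensor powers. -/
def relabel {n k : ℕ} (e : Fin k ≃ Fin n) : HatPower S n →L[ℝ] HatPower S k :=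
  (relabelL S e).completion

/-- The tensor product `V^{⊗ m} × V^{⊗ n} → V^{⊗ (m + n)}`. -/
def tmulAlg (m n : ℕ) : TPower S m →ₗ[ℝ] TPower S n →ₗ[ℝ] TPower S (m + n) :=
  ((TensorProduct.mk ℝ (⨂[ℝ]^m V) (⨂[ℝ]^n V)).compr₂
    (TensorPower.mulEquiv (R := ℝ) (M := V) (n := m) (m := n)).toLinearMap :
      (⨂[ℝ]^m V) →ₗ[ℝ] (⨂[ℝ]^n V) →ₗ[ℝ] (⨂[ℝ]^(m + n) V))

theorem continuous_tmulAlg (m n : ℕ) :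
    Continuous fun q : TPower S m × TPower S n => tmulAlg S m n q.1 q.2 := by
  have key : ∀ (i : Fin (m + n) → ι) (a : TPower S m) (b : TPower S n),
      TPower.seminorm S (m + n) i (tmulAlg S m n a b) =
        TPower.seminorm S m (fun j => i (Fin.castAdd n j)) a *
          TPower.seminorm S n (fun j => i (Fin.natAdd m j)) b := by
    intro i a b
    have h := S.cross m n (fun j => i (Fin.castAdd n j)) (fun j => i (Fin.natAdd m j)) a b
    rw [show Fin.append (fun j => i (Fin.castAdd n j)) (fun j => i (Fin.natAdd m j)) = i from
      Fin.append_castAdd_natAdd] at h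
    exact h
  rw [continuous_iff_continuousAt]
  rintro ⟨a, b⟩
  refine ((TPower.withSeminorms S (m + n)).tendsto_nhds _ _).2 fun i ε hε => ?_
  set P := TPower.seminorm S m (fun j => i (Fin.castAdd n j))
  set Q := TPower.seminorm S n (fun j => i (Fin.natAdd m j))
  have hP : Continuous P := (TPower.withSeminorms S m).continuous_seminorm _
  have hQ : Continuous Q := (TPower.withSeminorms S n).continuous_seminorm _
  have hc : Continuous fun q : TPower S m × TPower S n =>
      P (q.1 - a) * Q q.2 + P a * Q (q.2 - b) := by fun_prop
  have h0 := hc.tendsto (a, b)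
  simp only [sub_self, map_zero, zero_mul, mul_zero, add_zero] at h0
  filter_upwards [h0.eventually (gt_mem_nhds hε)] with q hq
  refine lt_of_le_of_lt ?_ hq
  have : tmulAlg S m n q.1 q.2 - tmulAlg S m n a b =
      tmulAlg S m n (q.1 - a) q.2 + tmulAlg S m n a (q.2 - b) := by
    simp only [map_sub, LinearMap.sub_apply]; abel
  rw [this, ← key, ← key]
  exact map_add_le_add _ _ _

/-- The tensor product `V^{⊗̂ m} × V^{⊗̂ n} → V^{⊗̂ (m + n)}`, the extension by continuity of the
algebraic one. -/
def tmul {m n : ℕ} (a : HatPower S m) (b : HatPower S n) : HatPower S (m + n) :=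
  IsDenseInducing.extend
    ((UniformSpace.Completion.isDenseInducing_toCompl (TPower S m)).prodMap
      (UniformSpace.Completion.isDenseInducing_toCompl (TPower S n)))
    (fun q : TPower S m × TPower S n => (tmulAlg S m n q.1 q.2 : HatPower S (m + n))) (a, b)

theorem continuous_tmul (m n : ℕ) :
    Continuous fun q : HatPower S m × HatPower S n => tmul S q.1 q.2 := by
  let φ : TPower S m →+ TPower S n →+ HatPower S (m + n) :=
    AddMonoidHom.mk'
      (fun a => UniformSpace.Completion.toCompl.comp (tmulAlg S m n a).toAddMonoidHom)
      (fun a a' => by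
        ext b
        change ((tmulAlg S m n (a + a') b : TPower S (m + n)) : HatPower S (m + n)) = _
        rw [map_add, LinearMap.add_apply, UniformSpace.Completion.coe_add]
        rfl)
  exact IsDenseInducing.extend_Z_bilin
    (UniformSpace.Completion.isDenseInducing_toCompl (TPower S m))
    (UniformSpace.Completion.isDenseInducing_toCompl (TPower S n)) (φ := φ)
    ((UniformSpace.Completion.continuous_coe _).comp (continuous_tmulAlg S m n))

theorem tmul_coe (m n : ℕ) (a : TPower S m) (b : TPower S n) :
    tmul S (a : HatPower S m) (b : HatPower S n) =
      ((tmulAlg S m n a b : TPower S (m + n)) : HatPower S (m + n)) :=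
  IsDenseInducing.extend_eq
    (f := fun q : TPower S m × TPower S n => (tmulAlg S m n q.1 q.2 : HatPower S (m + n))) _
    ((UniformSpace.Completion.continuous_coe _).comp (continuous_tmulAlg S m n)) (a, b)

/-- `sym_G a = |G|⁻¹ ∑_{σ ∈ G} σ a` on `V^{⊗̂ n}`. -/
def sym {n : ℕ} (G : Subgroup (Equiv.Perm (Fin n))) : HatPower S n →L[ℝ] HatPower S n :=
  open Classical in ((Fintype.card G : ℝ)⁻¹) • ∑ σ : G, relabel S (σ : Equiv.Perm (Fin n))

/-- The quotient `V^{⊗̂ n} / ker sym_G`, with the quotient topology. -/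
abbrev SymQuot {n : ℕ} (G : Subgroup (Equiv.Perm (Fin n))) : Type _ :=
  HatPower S n ⧸ LinearMap.ker (sym S G).toLinearMap

/-- The class `[a]` of a tensor. -/
def cls {n : ℕ} (G : Subgroup (Equiv.Perm (Fin n))) : HatPower S n →ₗ[ℝ] SymQuot S G :=
  Submodule.mkQ _

/-- The symmetric representative `sym_G a` of a class `[a]`. -/
def symRep {n : ℕ} (G : Subgroup (Equiv.Perm (Fin n))) : SymQuot S G →ₗ[ℝ] HatPower S n :=
  Submodule.liftQ _ (sym S G).toLinearMap le_rfl

/-- `V^{⊗̂ τ} = V^{⊗̂ |τ|} / ker sym_{SG(τ)}`. -/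
abbrev HatTree (τ : Tr) : Type _ := SymQuot S τ.rep.SG

/-- `SG(τ) × SG(σ)` as a group of permutations of `{1, …, |τ| + |σ|}`. -/
def SG₂ (τ σ : Tr) : Subgroup (Equiv.Perm (Fin (τ.1 + σ.1))) :=
  (τ.rep.SG.prod σ.rep.SG).map
    ((finSumFinEquiv.permCongrHom.toMonoidHom).comp (Equiv.Perm.sumCongrHom _ _))

/-- `V^{⊗̂ τ} ⊗̂ V^{⊗̂ σ}`: the completion of
`V^{⊗ τ} ⊗ V^{⊗ σ} = V^{⊗ (|τ| + |σ|)} / ker (sym_{SG(τ)} ⊗ sym_{SG(σ)})`,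
where `sym_{SG(τ)} ⊗ sym_{SG(σ)} = sym_{SG(τ) × SG(σ)}`. -/
abbrev HatTree₂ (τ σ : Tr) : Type _ := SymQuot S (SG₂ τ σ)

/-! ### The completed tree algebra -/

/-- The closure of `⨁_τ V^{⊗̂ τ}` in the product topology, that is, `∏_τ V^{⊗̂ τ}`. It is the
underlying space of the topological Grossman-Larson Hopf algebra. -/
abbrev HatTr : Type _ := (τ : Tr) → HatTree S τ

/-- The completed tensor product of `HatTr S` with itself. -/
abbrev HatTr₂ : Type _ := (q : Tr × Tr) → HatTree₂ S q.1 q.2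

/-- The unit `𝟏`, that is, `1 ∈ V^{⊗ 𝟏} = ℝ`. -/
def unit : HatTr S :=
  Pi.single (M := HatTree S) Tr.one
    (cls S Tr.one.rep.SG (TPower.toHat S 0 (PiTensorProduct.tprod ℝ (Fin.elim0 : Fin 0 → V))))

/-- The product `V^{⊗̂ τ} × V^{⊗̂ σ} → V^{⊗̂ (τ ∘ σ)}`: the tensor product of representatives,
relabelled along the enumeration of `τ ∘ σ`. The class does not depend on the representatives;
the symmetric ones are taken. -/
def circTree {τ σ : Tr} (a : HatTree S τ) (b : HatTree S σ) : HatTree S (τ.circ σ) :=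
  cls S _ (relabel S
    ((enumOf (τ.rep.Vert ⊕ σ.rep.Vert)).trans
      ((Equiv.sumCongr τ.rep.enum.symm σ.rep.enum.symm).trans finSumFinEquiv))
    (tmul S (symRep S _ a) (symRep S _ b)))

/-- The product `∘` on the completed tree algebra, extended bilinearly and continuously: the
component at `ρ` is the sum of `x_τ ∘ y_σ` over all `τ, σ` with `τ ∘ σ = ρ` (then
`|τ| + |σ| = |ρ|`). -/
def circ (x y : HatTr S) : HatTr S := fun ρ =>
  ∑ d ∈ Finset.HasAntidiagonal.antidiagonal ρ.1, ∑ τ : TreeClass d.1, ∑ σ : TreeClass d.2,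
    Pi.single (M := HatTree S) (Tr.circ ⟨d.1, τ⟩ ⟨d.2, σ⟩)
      (circTree S (x ⟨d.1, τ⟩) (y ⟨d.2, σ⟩)) ρ

/-- The powers `x^{∘ k}`. -/
def circPow (x : HatTr S) : ℕ → HatTr S
  | 0 => unit S
  | k + 1 => circ S (circPow x k) x

/-- `exp_∘ x = ∑_k x^{∘ k} / k!`, the sum being taken in the product topology. -/
def expCirc (x : HatTr S) : HatTr S := ∑' k : ℕ, ((k.factorial : ℝ)⁻¹) • circPow S x k

/-- The projection `π_k` onto trees whose root has exactly `k` children. -/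
def proj (k : ℕ) (x : HatTr S) : HatTr S := fun τ =>
  if τ.numRootChildren = k then x τ else 0

/-- The enumeration of the vertices of a tree in which those of `∘_{i ∈ I} t_i` come first and those
of `∘_{i ∉ I} t_i` come last, both in their own enumeration. -/
def splitEquiv {n : ℕ} (t : EnumTree n) (I : Finset t.Vert) :
    Fin ((t.branches I).1 + (t.coBranches I).1) ≃ Fin n :=
  finSumFinEquiv.symm.trans
    (((enumOf {v : t.Vert // t.InBranches I v}).sumCongr
      (enumOf {v : t.Vert // ¬ t.InBranches I v})).trans
        ((Equiv.sumCompl (t.InBranches I)).trans t.enum.symm))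

/-- The coproduct on `V^{⊗̂ τ}`: for an elementary labelled tree `t = t₁ ∘ ⋯ ∘ t_k`, with each `t_i`
a labelled tree whose root has one child,
`Δ t = ∑_{I ⊆ {1, …, k}} (∘_{i ∈ I} t_i) ⊗ (∘_{i ∉ I} t_i)`. The sets `I` are given as sets of
children of the root. The value does not depend on the representative of the class; the symmetric
one is taken. -/
def coprodTree {τ : Tr} (a : HatTree S τ) : HatTr₂ S :=
  ∑ I ∈ τ.rep.rootChildren.powerset,
    Pi.single (M := fun q : Tr × Tr => HatTree₂ S q.1 q.2) (τ.rep.branches I, τ.rep.coBranches I)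
      (cls S (SG₂ (τ.rep.branches I) (τ.rep.coBranches I))
        (relabel S (splitEquiv τ.rep I) (symRep S _ a)))

/-- The Grossman-Larson coproduct `Δ_GL`, extended linearly and continuously: the component at
`(ρ, σ)` is the sum of those of the `Δ x_τ`, and only trees `τ` with `|τ| = |ρ| + |σ|`
contribute. -/
def coprodGL (x : HatTr S) : HatTr₂ S := fun q =>
  ∑ τ : TreeClass (q.1.1 + q.2.1), coprodTree S (x ⟨q.1.1 + q.2.1, τ⟩) q

/-- The tensor `x ⊗ y`, with component `x_τ ⊗ y_σ` at `(τ, σ)`. -/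
def tensor (x y : HatTr S) : HatTr₂ S := fun q =>
  cls S _ (tmul S (symRep S _ (x q.1)) (symRep S _ (y q.2)))

/-- `x` is group-like: it is non-zero and `Δ_GL x = x ⊗ x`. -/
def IsGroupLike (x : HatTr S) : Prop := x ≠ 0 ∧ coprodGL S x = tensor S x x

end Construction

end LabelledTrees

end

open scoped TensorProduct

noncomputable section

namespace LabelledTrees

/-! ### Permutation actions, symmetrization and classes in completed tensor powers. -/

section Relabelling

variable {V : Type*} [AddCommGroup V] [Module ℝ V] [TopologicalSpace V] {ι : Type*}
  (S : SymmetricCrossSystem V ι)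

/-! Consider the convolution `id * π₁`: apply `Δ_GL`, then `π₁` to the second factor, then multiply
with `∘`. On `t₁ ∘ ⋯ ∘ t_k` only the `k` subsets whose complement is a single index survive, and
each of these summands multiplies back to `t₁ ∘ ⋯ ∘ t_k`. Hence `id * π₁` multiplies the component
at `ρ` by the number of children of its root (`convolution_id_proj_one`).

If `Δ_GL t = t ⊗ t`, the same convolution equals `t ∘ π₁ t`. Root children add up under `∘`, so
sorting by their number gives `(k + 1) π_{k+1} t = π_k t ∘ π₁ t` (`succ_smul_proj_succ`). By
induction `π_k t = (π₁ t)^{∘ k} / k!` as soon as `π₀ t = 𝟏`.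

The recursion also settles `π₀ t = c 𝟏`. If `c = 0`, every `π_k t` vanishes, against `t ≠ 0`; and
the component of `Δ_GL t = t ⊗ t` at `(𝟏, 𝟏)` reads `c = c²`. So `c = 1`
(`proj_zero_of_isGroupLike`). Finally `t = ∑_k π_k t`, where each tree receives exactly one summand
(`hasSum_proj`).

The bulk of the work is to check that splitting and multiplying respect enumerations up to tree
automorphisms, which the quotients do not see. -/

instance (n : ℕ) : ContinuousSMul ℝ (TPower S n) := (TPower.withSeminorms S n).continuousSMul

theorem relabel_coe {n k : ℕ} (e : Fin k ≃ Fin n) (a : TPower S n) :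
    relabel S e (a : HatPower S n) = (relabelL S e a : TPower S k) :=
  UniformSpace.Completion.map_coe (relabelL S e).uniformContinuous a

theorem relabelL_tprod {n k : ℕ} (e : Fin k ≃ Fin n) (v : Fin n → V) :
    relabelL S e (PiTensorProduct.tprod ℝ v : ⨂[ℝ]^n V) =
      (PiTensorProduct.tprod ℝ (v ∘ e) : ⨂[ℝ]^k V) :=
  PiTensorProduct.reindex_tprod e.symm v

theorem relabelL_relabelL {n k l : ℕ} (e : Fin k ≃ Fin n) (f : Fin l ≃ Fin k) (a : TPower S n) :
    relabelL S f (relabelL S e a) = relabelL S (f.trans e) a :=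
  PiTensorProduct.reindex_reindex (R := ℝ) (s := fun _ => V) e.symm f.symm a

theorem relabel_relabel {n k l : ℕ} (e : Fin k ≃ Fin n) (f : Fin l ≃ Fin k) (a : HatPower S n) :
    relabel S f (relabel S e a) = relabel S (f.trans e) a := by
  induction a using UniformSpace.Completion.induction_on with
  | hp => exact isClosed_eq (by fun_prop) (by fun_prop)
  | ih a => simp only [relabel_coe, relabelL_relabelL]

theorem relabel_refl {n : ℕ} (a : HatPower S n) : relabel S (Equiv.refl (Fin n)) a = a := by
  induction a using UniformSpace.Completion.induction_on with
  | hp => exact isClosed_eq (by fun_prop) (by fun_prop)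
  | ih a =>
    rw [relabel_coe]
    exact congrArg _ (congrArg (fun f => f a) (PiTensorProduct.reindex_refl (R := ℝ)
      (s := fun _ : Fin n => V)))

theorem sym_apply {n : ℕ} (G : Subgroup (Equiv.Perm (Fin n))) [Fintype G] (a : HatPower S n) :
    sym S G a = (Fintype.card G : ℝ)⁻¹ • ∑ σ : G, relabel S (σ : Equiv.Perm (Fin n)) a := by
  simp only [sym, _root_.smul_apply, _root_.sum_apply]
  congr!

theorem sym_eq_self {n : ℕ} (G : Subgroup (Equiv.Perm (Fin n))) {a : HatPower S n}
    (h : ∀ γ ∈ G, relabel S γ a = a) : sym S G a = a := by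
  classical
  rw [sym_apply, Finset.sum_congr rfl fun (σ : G) _ => h _ σ.property, Finset.sum_const, Finset.card_univ,
    ← Nat.cast_smul_eq_nsmul ℝ, smul_smul, inv_mul_cancel₀ (by simp), one_smul]

theorem sym_relabel {n : ℕ} (G : Subgroup (Equiv.Perm (Fin n))) {γ : Equiv.Perm (Fin n)}
    (hγ : γ ∈ G) (a : HatPower S n) : sym S G (relabel S γ a) = sym S G a := by
  classical
  rw [sym_apply, sym_apply]
  congr 1
  -- Relabelling by `γ` and then by `σ` is relabelling by `σ.trans γ = γ * σ`, hence left
  -- multiplication.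
  refine Fintype.sum_equiv (Equiv.mulLeft (⟨γ, hγ⟩ : G)) _ _ fun σ => ?_
  rw [relabel_relabel]
  rfl

theorem cls_relabel {n : ℕ} (G : Subgroup (Equiv.Perm (Fin n))) {γ : Equiv.Perm (Fin n)}
    (hγ : γ ∈ G) (a : HatPower S n) : cls S G (relabel S γ a) = cls S G a := by
  refine (Submodule.Quotient.eq _).2 (LinearMap.mem_ker.2 ?_)
  rw [map_sub]
  exact sub_eq_zero.2 (sym_relabel S G hγ a)

theorem symRep_cls {n : ℕ} (G : Subgroup (Equiv.Perm (Fin n))) (a : HatPower S n) :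
    symRep S G (cls S G a) = sym S G a := rfl

theorem exists_cls {n : ℕ} {G : Subgroup (Equiv.Perm (Fin n))} (a : SymQuot S G) :
    ∃ z, cls S G z = a :=
  Submodule.mkQ_surjective _ a

/-- A linear map that is invariant under `G` does not see the symmetrization. -/
theorem map_sym {n : ℕ} (G : Subgroup (Equiv.Perm (Fin n))) {M : Type*} [AddCommGroup M]
    [Module ℝ M] (f : HatPower S n →ₗ[ℝ] M) (a : HatPower S n)
    (h : ∀ γ ∈ G, f (relabel S γ a) = f a) : f (sym S G a) = f a := by
  classical
  rw [sym_apply, map_smul, map_sum, Finset.sum_congr rfl fun (σ : G) _ => h _ σ.property, Finset.sum_const,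
    Finset.card_univ, ← Nat.cast_smul_eq_nsmul ℝ, smul_smul, inv_mul_cancel₀ (by simp), one_smul]

/-- All `G`-translates of a tensor have the same class, hence so does their average. -/
theorem cls_symRep {n : ℕ} (G : Subgroup (Equiv.Perm (Fin n))) (a : SymQuot S G) :
    cls S G (symRep S G a) = a := by
  obtain ⟨z, rfl⟩ := exists_cls S a
  exact map_sym S G (cls S G) z fun γ hγ => cls_relabel S G hγ z

/-- The kernel of a continuous map is closed. The resulting Hausdorff property makes the sum that
defines `expCirc` unique. -/
instance {n : ℕ} (G : Subgroup (Equiv.Perm (Fin n))) : T3Space (SymQuot S G) := by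
  have : IsClosed (LinearMap.ker (sym S G).toLinearMap : Set (HatPower S n)) :=
    (sym S G).isClosed_ker
  exact Submodule.t3_quotient_of_isClosed _

/-! ### Scalars and the zeroth tensor power. -/

theorem tmul_smul_left {m n : ℕ} (c : ℝ) (a : HatPower S m) (b : HatPower S n) :
    tmul S (c • a) b = c • tmul S a b := by
  have hc := continuous_tmul S m n
  have h₁ : Continuous fun q : HatPower S m × HatPower S n => (c • q.1, q.2) :=
    (continuous_fst.const_smul c).prodMk continuous_snd
  have h₂ := hc.comp h₁
  have h₃ := hc.const_smul c
  have h₄ : IsClosed {q : HatPower S m × HatPower S n |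
      tmul S (c • q.1) q.2 = c • tmul S q.1 q.2} := isClosed_eq h₂ h₃
  refine UniformSpace.Completion.induction_on₂
    (p := fun a b => tmul S (c • a) b = c • tmul S a b) a b h₄ fun a b => ?_
  rw [← UniformSpace.Completion.coe_smul, tmul_coe, tmul_coe, map_smul, LinearMap.smul_apply,
    UniformSpace.Completion.coe_smul]

theorem tmul_smul_right {m n : ℕ} (c : ℝ) (a : HatPower S m) (b : HatPower S n) :
    tmul S a (c • b) = c • tmul S a b := by
  have hc := continuous_tmul S m n
  have h₁ : Continuous fun q : HatPower S m × HatPower S n => (q.1, c • q.2) :=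
    continuous_fst.prodMk (continuous_snd.const_smul c)
  have h₂ := hc.comp h₁
  have h₃ := hc.const_smul c
  have h₄ : IsClosed {q : HatPower S m × HatPower S n |
      tmul S q.1 (c • q.2) = c • tmul S q.1 q.2} := isClosed_eq h₂ h₃
  refine UniformSpace.Completion.induction_on₂
    (p := fun a b => tmul S a (c • b) = c • tmul S a b) a b h₄ fun a b => ?_
  rw [← UniformSpace.Completion.coe_smul, tmul_coe, tmul_coe, map_smul,
    UniformSpace.Completion.coe_smul]

/-- The element `1 ∈ V^{⊗̂ 0}`, for a degree that is propositionally `0`. -/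
def scalarOne (n : ℕ) (h : n = 0) : HatPower S n :=
  TPower.toHat S n (PiTensorProduct.tprod ℝ fun i => (Fin.cast h i).elim0)

theorem relabel_scalarOne {n k : ℕ} (hn : n = 0) (hk : k = 0) (e : Fin k ≃ Fin n) :
    relabel S e (scalarOne S n hn) = scalarOne S k hk := by
  subst hk
  refine (relabel_coe S e _).trans ?_
  refine (congrArg _ (relabelL_tprod S e _)).trans ?_
  exact congrArg (fun v => TPower.toHat S 0 (PiTensorProduct.tprod ℝ v)) (Subsingleton.elim _ _)

theorem tmul_scalarOne {n k : ℕ} (hn : n = 0) (hk : k = 0) (h : n + k = 0) :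
    tmul S (scalarOne S n hn) (scalarOne S k hk) = scalarOne S (n + k) h := by
  subst hn hk
  refine (tmul_coe S 0 0 _ _).trans ?_
  refine (congrArg _ (TensorPower.tprod_mul_tprod ℝ _ _)).trans ?_
  exact congrArg (fun v => TPower.toHat S 0 (PiTensorProduct.tprod ℝ v)) (Subsingleton.elim _ _)

theorem sym_scalarOne {n : ℕ} (h : n = 0) (G : Subgroup (Equiv.Perm (Fin n))) :
    sym S G (scalarOne S n h) = scalarOne S n h :=
  sym_eq_self S G fun γ _ => relabel_scalarOne S h h γ

theorem TPower.eq_smul_tprod (a : TPower S 0) :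
    a = PiTensorProduct.isEmptyEquiv (R := ℝ) (s := fun _ => V) (Fin 0) a •
      (PiTensorProduct.tprod ℝ Fin.elim0 : ⨂[ℝ]^0 V) := by
  rw [Subsingleton.elim (Fin.elim0 : Fin 0 → V) isEmptyElim]
  exact ((PiTensorProduct.isEmptyEquiv (R := ℝ) (s := fun _ => V) (Fin 0)).symm_apply_apply a).symm

/-- The identification of `V^{⊗ 0}` with `ℝ`. -/
def scalarPart : TPower S 0 →L[ℝ] ℝ where
  toLinearMap := (PiTensorProduct.isEmptyEquiv (R := ℝ) (s := fun _ => V) (Fin 0)).toLinearMap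
  cont := by
    refine (TPower.withSeminorms S 0).continuous_of_isBounded (norm_withSeminorms ℝ ℝ) _
      fun _ => ⟨{Fin.elim0}, 1, fun a => ?_⟩
    rw [Finset.sup_singleton, one_smul]
    conv_rhs => rw [TPower.eq_smul_tprod S a]
    exact (S.p_zero _ _ _).ge

/-- Completing `V^{⊗ 0}` adds nothing: it is `ℝ` with the absolute value, so the coefficient
functional extends to the completion, and the identity passes to limits. -/
theorem exists_eq_smul_scalarOne {n : ℕ} (h : n = 0) (a : HatPower S n) :
    ∃ c : ℝ, c • scalarOne S n h = a := by
  subst h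
  refine ⟨UniformSpace.Completion.extension (scalarPart S) a, ?_⟩
  have h₀ : Continuous fun c : ℝ => c • scalarOne S 0 rfl := by
    let u : TPower S 0 := (PiTensorProduct.tprod ℝ fun i => i.elim0 : ⨂[ℝ]^0 V)
    have : Continuous fun c : ℝ => c • u := by fun_prop
    refine ((UniformSpace.Completion.continuous_coe _).comp this).congr fun c => ?_
    exact UniformSpace.Completion.coe_smul (X := TPower S 0) c _
  refine UniformSpace.Completion.induction_on a
    (isClosed_eq (h₀.comp UniformSpace.Completion.continuous_extension) continuous_id) fun a => ?_
  rw [UniformSpace.Completion.extension_coe (scalarPart S).uniformContinuous]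
  conv_rhs => rw [TPower.eq_smul_tprod S a]
  exact (UniformSpace.Completion.coe_smul (X := TPower S 0) _ _).symm

end Relabelling

/-! ### Minimal vertices and branches -/

theorem EnumTree.mem_rootChildren {n : ℕ} (t : EnumTree n) (w : t.Vert) :
    w ∈ t.rootChildren ↔ IsMin w := by
  simp only [EnumTree.rootChildren, Finset.mem_filter, Finset.mem_univ, true_and,
    WithBot.bot_covBy_coe]

theorem Tr.numRootChildren_eq (τ : Tr) :
    τ.numRootChildren = Nat.card {v : τ.rep.Vert // IsMin v} := by
  rw [Tr.numRootChildren, ← Nat.card_eq_finsetCard]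
  exact Nat.card_congr (Equiv.subtypeEquivRight fun w => τ.rep.mem_rootChildren w)

/-- The order isomorphism underlying `enumOf`. -/
def repIso (X : Type) [Fintype X] [PartialOrder X] [IsVertexPoset X] :
    (treeOf X).rep.Vert ≃o X :=
  Classical.choice (nonempty_iso_rep X)

theorem numRootChildren_treeOf (X : Type) [Fintype X] [PartialOrder X] [IsVertexPoset X] :
    (treeOf X).numRootChildren = Nat.card {x : X // IsMin x} := by
  rw [Tr.numRootChildren_eq]
  refine Nat.card_congr ((repIso X).toEquiv.subtypeEquiv fun v => ?_)
  exact (OrderIso.isMin_apply (repIso X)).symm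

theorem numRootChildren_circ (τ σ : Tr) :
    (τ.circ σ).numRootChildren = τ.numRootChildren + σ.numRootChildren := by
  rw [Tr.circ, numRootChildren_treeOf, Tr.numRootChildren_eq, Tr.numRootChildren_eq,
    ← Nat.card_sum]
  refine Nat.card_congr (Equiv.subtypeSum.trans (Equiv.sumCongr ?_ ?_)) <;>
  · refine Equiv.subtypeEquivRight fun v => ?_
    simp [IsMin]

theorem EnumTree.inBranches_of_isMin {n : ℕ} {t : EnumTree n} {I : Finset t.Vert} {v : t.Vert}
    (hv : IsMin v) : t.InBranches I v ↔ v ∈ I := by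
  constructor
  · rintro ⟨c, hc, hcv⟩
    rwa [hv.eq_of_le hcv] at hc
  · exact fun h => ⟨v, h, le_rfl⟩

theorem EnumTree.InBranches.mono {n : ℕ} {t : EnumTree n} {I : Finset t.Vert} {v w : t.Vert}
    (hv : t.InBranches I v) (h : v ≤ w) : t.InBranches I w :=
  let ⟨c, hc, hcv⟩ := hv
  ⟨c, hc, hcv.trans h⟩

/-- The tree condition enters here: a root child `c` below `w` and a vertex `v` below `w` are
comparable, and minimality of `c` forces `c ≤ v`. Thus branches are closed downwards as well as
upwards. -/
theorem EnumTree.InBranches.of_le {n : ℕ} {t : EnumTree n} {I : Finset t.Vert}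
    (hI : I ⊆ t.rootChildren) {v w : t.Vert} (hw : t.InBranches I w) (h : v ≤ w) :
    t.InBranches I v := by
  obtain ⟨c, hc, hcw⟩ := hw
  have hmin := (t.mem_rootChildren c).1 (hI hc)
  suffices c ≤ v from ⟨c, hc, this⟩
  rcases h.eq_or_lt with rfl | hv
  · exact hcw
  rcases hcw.eq_or_lt with rfl | hc'
  · exact hmin hv.le
  rcases eq_or_ne c v with rfl | hne
  · rfl
  · exact ((isVertexPoset_iff t.Vert).1 inferInstance w hc' hv hne).elim id fun h => hmin h

/-- The vertices outside the branches form a lower set, so minimality there is the same as in the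
whole tree. -/
theorem EnumTree.isMin_coBranches {n : ℕ} (t : EnumTree n) {I : Finset t.Vert}
    (v : {v : t.Vert // ¬ t.InBranches I v}) :
    IsMin v ↔ IsMin (v : t.Vert) :=
  ⟨fun h w hw => h (b := ⟨w, fun hwI => v.2 (hwI.mono hw)⟩) hw, fun h _ hw => h hw⟩

/-- Turns the condition imposed by `π₁` on the second factor of the coproduct into a condition on
`I`. -/
theorem EnumTree.numRootChildren_coBranches {n : ℕ} (t : EnumTree n) (I : Finset t.Vert) :
    (t.coBranches I).numRootChildren = (t.rootChildren \ I).card := by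
  rw [EnumTree.coBranches, numRootChildren_treeOf, ← Nat.card_eq_finsetCard]
  refine Nat.card_congr (((Equiv.subtypeEquivRight fun v => t.isMin_coBranches v).trans
    (Equiv.subtypeSubtypeEquivSubtypeInter (fun v => ¬ t.InBranches I v) IsMin)).trans
      (Equiv.subtypeEquivRight fun v => ?_))
  rw [Finset.mem_sdiff, t.mem_rootChildren, and_comm]
  exact and_congr_right fun hv => not_congr (EnumTree.inBranches_of_isMin hv)

/-- A tree is the product of the branches in `I` and the remaining ones. -/
def EnumTree.branchesIso {n : ℕ} (t : EnumTree n) {I : Finset t.Vert} (hI : I ⊆ t.rootChildren) :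
    {v : t.Vert // t.InBranches I v} ⊕ {v : t.Vert // ¬ t.InBranches I v} ≃o t.Vert where
  toEquiv := Equiv.sumCompl (t.InBranches I)
  map_rel_iff' := by
    rintro (v | v) (w | w)
    · simp
    · simpa using fun h => w.2 (v.2.mono h)
    · simpa using fun h => v.2 (w.2.of_le hI h)
    · simp

/-- Complementation matches these subsets with the singletons. This count is the source of the
factor `ρ.numRootChildren`. -/
theorem card_filter_sdiff_card_eq_one {α : Type*} [DecidableEq α] (s : Finset α) :
    (s.powerset.filter fun I => (s \ I).card = 1).card = s.card := by
  rw [← Nat.choose_one_right s.card, ← Finset.card_powersetCard]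
  refine Finset.card_nbij' (s \ ·) (s \ ·) ?_ ?_ ?_ ?_ <;> intro I hI <;>
    simp_all [Finset.mem_powersetCard]

/-! ### Isomorphic trees, and compatibility of enumerations with splitting and joining. -/

theorem Tr.ext_of_orderIso {τ σ : Tr} (φ : τ.rep.Vert ≃o σ.rep.Vert) : τ = σ := by
  obtain ⟨n, c⟩ := τ
  obtain ⟨m, d⟩ := σ
  obtain rfl : n = m := by simpa using Fintype.card_congr (show Fin n ≃ Fin m from φ.toEquiv)
  rw [show c = d from Quotient.out_equiv_out.1 ⟨φ.withBotCongr⟩]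

theorem EnumTree.orderIso_mem_SG {n : ℕ} (t : EnumTree n) (φ : t.Vert ≃o t.Vert) :
    (φ.toEquiv : Equiv.Perm (Fin n)) ∈ t.SG :=
  fun _ _ => φ.map_rel_iff

/-- A member of the symmetry group as an order automorphism. -/
def EnumTree.autOfMemSG {n : ℕ} (t : EnumTree n) {g : Equiv.Perm (Fin n)} (hg : g ∈ t.SG) :
    t.Vert ≃o t.Vert where
  toEquiv := g
  map_rel_iff' := fun {v w} => hg v w

/-- The enumeration of the non-root vertices of `τ ∘ σ` used in the product. -/
def circEquiv (τ σ : Tr) : Fin (τ.circ σ).1 ≃ Fin (τ.1 + σ.1) :=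
  (enumOf (τ.rep.Vert ⊕ σ.rep.Vert)).trans
    ((Equiv.sumCongr τ.rep.enum.symm σ.rep.enum.symm).trans finSumFinEquiv)

theorem finSumFinEquiv_symm_circEquiv (τ σ : Tr) (v : Fin (τ.circ σ).1) :
    finSumFinEquiv.symm (circEquiv τ σ v) = Sum.map τ.rep.enum.symm σ.rep.enum.symm
      (enumOf (τ.rep.Vert ⊕ σ.rep.Vert) v) :=
  finSumFinEquiv.symm_apply_apply _

theorem circEquiv_symm_apply (τ σ : Tr) (v : Fin (τ.1 + σ.1)) :
    (circEquiv τ σ).symm v = (enumOf (τ.rep.Vert ⊕ σ.rep.Vert)).symm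
      (Sum.map τ.rep.enum σ.rep.enum (finSumFinEquiv.symm v)) :=
  rfl

/-- Automorphisms of the two factors act side by side on the disjoint union of their vertices and
give an automorphism of the joined tree. This makes the product well defined on classes modulo `SG₂
τ σ`. -/
theorem conj_circEquiv_mem_SG {τ σ : Tr} {γ : Equiv.Perm (Fin (τ.1 + σ.1))} (hγ : γ ∈ SG₂ τ σ) :
    (circEquiv τ σ).trans (γ.trans (circEquiv τ σ).symm) ∈ (τ.circ σ).rep.SG := by
  obtain ⟨⟨g, h⟩, ⟨hg, hh⟩, rfl⟩ := hγ
  let φ : (τ.circ σ).rep.Vert ≃o (τ.circ σ).rep.Vert :=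
    ((repIso (τ.rep.Vert ⊕ σ.rep.Vert)).trans
      (OrderIso.sumCongr (τ.rep.autOfMemSG hg) (σ.rep.autOfMemSG hh))).trans
        (repIso (τ.rep.Vert ⊕ σ.rep.Vert)).symm
  refine (congrArg (· ∈ (τ.circ σ).rep.SG) (Equiv.ext fun v => ?_)).mpr
    ((τ.circ σ).rep.orderIso_mem_SG φ)
  change (circEquiv τ σ).symm (finSumFinEquiv (Sum.map g h (finSumFinEquiv.symm
    (circEquiv τ σ v)))) = _
  rw [circEquiv_symm_apply, finSumFinEquiv_symm_circEquiv, Equiv.symm_apply_apply]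
  generalize hw : enumOf (τ.rep.Vert ⊕ σ.rep.Vert) v = w
  have hφ : φ v = (enumOf (τ.rep.Vert ⊕ σ.rep.Vert)).symm (Sum.map g h w) := by
    rw [← hw]
    rfl
  refine Eq.trans ?_ hφ.symm
  cases w <;> rfl

/-- Splitting a tree into branches and multiplying again is an order isomorphism. -/
def EnumTree.recombineIso {n : ℕ} (t : EnumTree n) {I : Finset t.Vert}
    (hI : I ⊆ t.rootChildren) :
    ((t.branches I).circ (t.coBranches I)).rep.Vert ≃o t.Vert :=
  ((repIso _).trans (OrderIso.sumCongr (repIso _) (repIso _))).trans (t.branchesIso hI)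

/-- The bijection obtained by joining and splitting underlies an order isomorphism, so
`single_cls_relabel` can absorb it. -/
theorem EnumTree.splitEquiv_circEquiv {n : ℕ} (t : EnumTree n) {I : Finset t.Vert}
    (hI : I ⊆ t.rootChildren) (v : Fin ((t.branches I).circ (t.coBranches I)).1) :
    splitEquiv t I (circEquiv (t.branches I) (t.coBranches I) v) =
      t.enum.symm (t.recombineIso hI (((t.branches I).circ (t.coBranches I)).rep.enum v)) := by
  refine (congrArg (fun u => t.enum.symm (Equiv.sumCompl (t.InBranches I)
    (Sum.map (enumOf {v : t.Vert // t.InBranches I v})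
      (enumOf {v : t.Vert // ¬ t.InBranches I v}) u)))
    (finSumFinEquiv_symm_circEquiv _ _ v)).trans ?_
  generalize hw : enumOf ((t.branches I).rep.Vert ⊕ (t.coBranches I).rep.Vert) v = w
  have h : t.recombineIso hI (((t.branches I).circ (t.coBranches I)).rep.enum v) =
      Equiv.sumCompl (t.InBranches I) (Sum.map (repIso _) (repIso _) w) := by
    rw [← hw]
    rfl
  refine Eq.trans ?_ (congrArg t.enum.symm h).symm
  cases w <;> rfl

section Components

variable {V : Type*} [AddCommGroup V] [Module ℝ V] [TopologicalSpace V] {ι : Type*}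
  (S : SymmetricCrossSystem V ι)

/-! ### Multiplying the two factors of a tensor -/

/-- Isomorphic relabellings place a tensor at the same spot of the tree algebra. -/
theorem single_cls_relabel {n : ℕ} {τ σ : Tr} (e : Fin τ.1 ≃ Fin n) (f : Fin σ.1 ≃ Fin n)
    (φ : τ.rep.Vert ≃o σ.rep.Vert)
    (h : ∀ v : Fin τ.1, f (σ.rep.enum.symm (φ (τ.rep.enum v))) = e v) (z : HatPower S n) :
    Pi.single (M := HatTree S) τ (cls S τ.rep.SG (relabel S e z)) =
      Pi.single (M := HatTree S) σ (cls S σ.rep.SG (relabel S f z)) := by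
  obtain rfl := Tr.ext_of_orderIso φ
  congr 1
  obtain ⟨γ, hγ, rfl⟩ : ∃ γ ∈ τ.rep.SG, e = γ.trans f :=
    ⟨_, τ.rep.orderIso_mem_SG φ, Equiv.ext fun v => (h v).symm⟩
  rw [← relabel_relabel, cls_relabel S τ.rep.SG hγ]

/-- The product `V^{⊗̂ τ} ⊗̂ V^{⊗̂ σ} → V^{⊗̂ (τ ∘ σ)}` on the completed tensor product. -/
def circTree₂ (τ σ : Tr) : HatTree₂ S τ σ →ₗ[ℝ] HatTree S (τ.circ σ) :=
  cls S (τ.circ σ).rep.SG ∘ₗ (relabel S (circEquiv τ σ)).toLinearMap ∘ₗ symRep S (SG₂ τ σ)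

/-- By `conj_circEquiv_mem_SG`, a permutation in `SG₂ τ σ` becomes an automorphism of `τ ∘ σ` after
relabelling, so the target class ignores the symmetrization. -/
theorem circTree₂_cls (τ σ : Tr) (z : HatPower S (τ.1 + σ.1)) :
    circTree₂ S τ σ (cls S (SG₂ τ σ) z) =
      cls S (τ.circ σ).rep.SG (relabel S (circEquiv τ σ) z) := by
  refine map_sym S (SG₂ τ σ)
    (cls S (τ.circ σ).rep.SG ∘ₗ (relabel S (circEquiv τ σ)).toLinearMap) z fun γ hγ => ?_
  change cls S _ (relabel S (circEquiv τ σ) (relabel S γ z)) =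
    cls S _ (relabel S (circEquiv τ σ) z)
  rw [← cls_relabel S _ (conj_circEquiv_mem_SG hγ) (relabel S (circEquiv τ σ) z),
    relabel_relabel, relabel_relabel]
  congr 3
  ext v
  simp

theorem circTree₂_tensor (x y : HatTr S) (τ σ : Tr) :
    circTree₂ S τ σ (tensor S x y (τ, σ)) = circTree S (x τ) (y σ) :=
  circTree₂_cls S τ σ _

/-- Every summand of the coproduct multiplies back to the original element. Both sides are placed in
the product space by `Pi.single` because the recombined tree equals `ρ` only propositionally. -/
theorem single_circTree₂_split {ρ : Tr} (a : HatTree S ρ) {I : Finset ρ.rep.Vert}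
    (hI : I ⊆ ρ.rep.rootChildren) :
    Pi.single (M := HatTree S) ((ρ.rep.branches I).circ (ρ.rep.coBranches I))
      (circTree₂ S (ρ.rep.branches I) (ρ.rep.coBranches I)
        (cls S (SG₂ (ρ.rep.branches I) (ρ.rep.coBranches I))
          (relabel S (splitEquiv ρ.rep I) (symRep S _ a)))) = Pi.single (M := HatTree S) ρ a := by
  rw [circTree₂_cls, relabel_relabel]
  refine (single_cls_relabel S ((circEquiv _ _).trans (splitEquiv ρ.rep I)) (Equiv.refl _)
    (ρ.rep.recombineIso hI) (fun v => (ρ.rep.splitEquiv_circEquiv hI v).symm) _).trans ?_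
  rw [relabel_refl, cls_symRep]

/-! ### Sums over pairs of trees of a given total degree -/

theorem sum_antidiagonal_trees_eq {M : Type*} [AddCommMonoid M] {n : ℕ} (F : Tr → Tr → M)
    (p : Tr × Tr) (hp : p.1.1 + p.2.1 = n) (h : ∀ τ σ, (τ, σ) ≠ p → F τ σ = 0) :
    ∑ d ∈ Finset.HasAntidiagonal.antidiagonal n, ∑ τ : TreeClass d.1, ∑ σ : TreeClass d.2,
      F ⟨d.1, τ⟩ ⟨d.2, σ⟩ = F p.1 p.2 := by
  classical
  obtain ⟨⟨k, τ⟩, ⟨l, σ⟩⟩ := p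
  rw [Finset.sum_eq_single (k, l), Finset.sum_eq_single τ, Finset.sum_eq_single σ]
  · exact fun σ' _ hσ => h _ _ (by simpa using hσ)
  · simp
  · exact fun τ' _ hτ => Finset.sum_eq_zero fun σ' _ => h _ _ (by simp [hτ])
  · simp
  · rintro ⟨k', l'⟩ _ hd
    refine Finset.sum_eq_zero fun τ' _ => Finset.sum_eq_zero fun σ' _ => h _ _ fun hh => hd ?_
    simp only [Prod.mk.injEq] at hh ⊢
    exact ⟨congrArg Sigma.fst hh.1, congrArg Sigma.fst hh.2⟩
  · exact fun hn => absurd (Finset.HasAntidiagonal.mem_antidiagonal.2 hp) hn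

/-- The degree is a free variable `n`, so that the sum can be indexed by `TreeClass n` without
casts. -/
theorem coprodGL_apply {n : ℕ} (x : HatTr S) (q : Tr × Tr) (h : q.1.1 + q.2.1 = n) :
    coprodGL S x q = ∑ τ : TreeClass n, coprodTree S (x ⟨n, τ⟩) q := by
  subst h
  rfl

theorem EnumTree.card_branches_add {n : ℕ} (t : EnumTree n) (I : Finset t.Vert) :
    (t.branches I).1 + (t.coBranches I).1 = n := by
  simpa using Fintype.card_congr (splitEquiv t I)

/-- The convolution of the identity with `π₁` counts the children of the root. -/
theorem convolution_id_proj_one (x : HatTr S) (ρ : Tr) :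
    ∑ d ∈ Finset.HasAntidiagonal.antidiagonal ρ.1, ∑ τ : TreeClass d.1, ∑ σ : TreeClass d.2,
      Pi.single (M := HatTree S) (Tr.circ ⟨d.1, τ⟩ ⟨d.2, σ⟩)
        (if Tr.numRootChildren ⟨d.2, σ⟩ = 1 then
          circTree₂ S _ _ (coprodGL S x (⟨d.1, τ⟩, ⟨d.2, σ⟩)) else 0) ρ =
      ρ.numRootChildren • x ρ := by
  classical
  -- One linear map combines the cut-off by `π₁`, the product and the evaluation at `ρ`, so it can
  -- be moved through the sums that define the coproduct.
  set G : (q : Tr × Tr) → HatTree₂ S q.1 q.2 →ₗ[ℝ] HatTree S ρ := fun q =>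
    if q.2.numRootChildren = 1 then
      LinearMap.proj (φ := HatTree S) ρ ∘ₗ LinearMap.single ℝ (HatTree S) (q.1.circ q.2) ∘ₗ
        circTree₂ S q.1 q.2 else 0 with hG
  have hGapp : ∀ τ σ (w : HatTree₂ S τ σ), Pi.single (M := HatTree S) (τ.circ σ)
      (if σ.numRootChildren = 1 then circTree₂ S τ σ w else 0) ρ = G (τ, σ) w := by
    intro τ σ w
    simp only [hG]
    split_ifs
    · rfl
    · simp
  have hsplit : ∀ (τ' : TreeClass ρ.1) (I : Finset (Tr.rep ⟨ρ.1, τ'⟩).Vert)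
      (w : HatTree₂ S ((Tr.rep ⟨ρ.1, τ'⟩).branches I) ((Tr.rep ⟨ρ.1, τ'⟩).coBranches I)),
      ∑ d ∈ Finset.HasAntidiagonal.antidiagonal ρ.1, ∑ τ : TreeClass d.1, ∑ σ : TreeClass d.2,
        G (⟨d.1, τ⟩, ⟨d.2, σ⟩) (Pi.single (M := fun q : Tr × Tr => HatTree₂ S q.1 q.2)
          ((Tr.rep ⟨ρ.1, τ'⟩).branches I, (Tr.rep ⟨ρ.1, τ'⟩).coBranches I) w
            (⟨d.1, τ⟩, ⟨d.2, σ⟩)) =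
          G ((Tr.rep ⟨ρ.1, τ'⟩).branches I, (Tr.rep ⟨ρ.1, τ'⟩).coBranches I) w := by
    intro τ' I w
    refine (sum_antidiagonal_trees_eq (fun τ σ => G (τ, σ)
      (Pi.single (M := fun q : Tr × Tr => HatTree₂ S q.1 q.2)
        ((Tr.rep ⟨ρ.1, τ'⟩).branches I, (Tr.rep ⟨ρ.1, τ'⟩).coBranches I) w (τ, σ)))
      ((Tr.rep ⟨ρ.1, τ'⟩).branches I, (Tr.rep ⟨ρ.1, τ'⟩).coBranches I)
      (EnumTree.card_branches_add _ I) fun τ σ hne => ?_).trans ?_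
    · rw [Pi.single_eq_of_ne hne, map_zero]
    · exact congrArg _ (Pi.single_eq_same _ _)
  have hterm : ∀ (τ' : TreeClass ρ.1), ∀ I ∈ (Tr.rep ⟨ρ.1, τ'⟩).rootChildren.powerset,
      G ((Tr.rep ⟨ρ.1, τ'⟩).branches I, (Tr.rep ⟨ρ.1, τ'⟩).coBranches I)
        (cls S (SG₂ ((Tr.rep ⟨ρ.1, τ'⟩).branches I) ((Tr.rep ⟨ρ.1, τ'⟩).coBranches I))
          (relabel S (splitEquiv (Tr.rep ⟨ρ.1, τ'⟩) I) (symRep S _ (x ⟨ρ.1, τ'⟩)))) =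
      if ((Tr.rep ⟨ρ.1, τ'⟩).rootChildren \ I).card = 1 then
        Pi.single (M := HatTree S) ⟨ρ.1, τ'⟩ (x ⟨ρ.1, τ'⟩) ρ else 0 := by
    intro τ' I hI
    rw [← hGapp, EnumTree.numRootChildren_coBranches]
    split_ifs
    · exact congrFun (single_circTree₂_split S (ρ := ⟨ρ.1, τ'⟩) (x ⟨ρ.1, τ'⟩)
        (Finset.mem_powerset.1 hI)) ρ
    · simp
  calc _ = ∑ d ∈ Finset.HasAntidiagonal.antidiagonal ρ.1, ∑ τ : TreeClass d.1,
        ∑ σ : TreeClass d.2, ∑ τ' : TreeClass ρ.1,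
          ∑ I ∈ (Tr.rep ⟨ρ.1, τ'⟩).rootChildren.powerset,
            G (⟨d.1, τ⟩, ⟨d.2, σ⟩) (Pi.single (M := fun q : Tr × Tr => HatTree₂ S q.1 q.2)
              ((Tr.rep ⟨ρ.1, τ'⟩).branches I, (Tr.rep ⟨ρ.1, τ'⟩).coBranches I)
              (cls S (SG₂ ((Tr.rep ⟨ρ.1, τ'⟩).branches I) ((Tr.rep ⟨ρ.1, τ'⟩).coBranches I))
                (relabel S (splitEquiv (Tr.rep ⟨ρ.1, τ'⟩) I) (symRep S _ (x ⟨ρ.1, τ'⟩))))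
              (⟨d.1, τ⟩, ⟨d.2, σ⟩)) := by
        refine Finset.sum_congr rfl fun d hd => Finset.sum_congr rfl fun τ _ =>
          Finset.sum_congr rfl fun σ _ => ?_
        rw [hGapp, coprodGL_apply S x _ (Finset.HasAntidiagonal.mem_antidiagonal.1 hd), map_sum]
        refine Finset.sum_congr rfl fun τ' _ => ?_
        rw [coprodTree, Finset.sum_apply, map_sum]
    _ = ∑ τ' : TreeClass ρ.1, ∑ I ∈ (Tr.rep ⟨ρ.1, τ'⟩).rootChildren.powerset,
          if ((Tr.rep ⟨ρ.1, τ'⟩).rootChildren \ I).card = 1 then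
            Pi.single (M := HatTree S) ⟨ρ.1, τ'⟩ (x ⟨ρ.1, τ'⟩) ρ else 0 := by
        -- With `τ'` and `I` outermost, the sum over pairs of trees collapses to the one pair
        -- produced by that splitting.
        simp_rw [Finset.sum_comm (t := (Finset.univ : Finset (TreeClass ρ.1)))]
        refine Finset.sum_congr rfl fun τ' _ => ?_
        simp_rw [Finset.sum_comm (t := (Tr.rep ⟨ρ.1, τ'⟩).rootChildren.powerset)]
        refine Finset.sum_congr rfl fun I hI => ?_
        rw [hsplit, hterm τ' I hI]
    _ = ρ.numRootChildren • x ρ := by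
        obtain ⟨n, r⟩ := ρ
        rw [Finset.sum_eq_single r]
        · rw [Pi.single_eq_same, ← Finset.sum_filter, Finset.sum_const,
            card_filter_sdiff_card_eq_one]
          rfl
        · intro τ' _ hτ
          rw [Pi.single_eq_of_ne (by simpa using hτ.symm)]
          simp
        · simp

end Components

/-! ### The trivial tree and degree zero. -/

theorem Tr.numRootChildren_eq_zero (τ : Tr) : τ.numRootChildren = 0 ↔ τ = Tr.one := by
  rw [Tr.numRootChildren_eq, Finite.card_eq_zero_iff]
  constructor
  · intro h
    have hτ : IsEmpty τ.rep.Vert := by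
      by_contra hne
      rw [not_isEmpty_iff] at hne
      obtain ⟨m, hm⟩ := Set.finite_univ.exists_minimal (s := (Set.univ : Set τ.rep.Vert))
        Set.univ_nonempty
      exact h.false ⟨m, fun b hb => hm.2 (Set.mem_univ b) hb⟩
    have h1 : IsEmpty Tr.one.rep.Vert := inferInstanceAs (IsEmpty (Fin 0))
    exact Tr.ext_of_orderIso ⟨Equiv.equivOfIsEmpty _ _, fun {v} => hτ.elim v⟩
  · rintro rfl
    have h1 : IsEmpty Tr.one.rep.Vert := inferInstanceAs (IsEmpty (Fin 0))
    infer_instance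

theorem Tr.eq_one_of_degree {τ : Tr} (h : τ.1 = 0) : τ = Tr.one := by
  rw [← Tr.numRootChildren_eq_zero, Tr.numRootChildren_eq, Finite.card_eq_zero_iff]
  exact ⟨fun v => (Fin.cast h (τ.rep.enum.symm v.1)).elim0⟩

instance : Unique (TreeClass 0) where
  default := Tr.one.2
  uniq c := eq_of_heq (Sigma.mk.inj (Tr.eq_one_of_degree (τ := ⟨0, c⟩) rfl)).2

theorem Tr.one_degree : Tr.one.1 = 0 := rfl

theorem Tr.one_degree_add : Tr.one.1 + Tr.one.1 = 0 := rfl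

/-! ### The recursion for group-like elements and the exponential series. -/

section Exponential

variable {V : Type*} [AddCommGroup V] [Module ℝ V] [TopologicalSpace V] {ι : Type*}
  (S : SymmetricCrossSystem V ι)

theorem circTree_eq {τ σ : Tr} (a : HatTree S τ) (b : HatTree S σ) :
    circTree S a b = cls S (τ.circ σ).rep.SG
      (relabel S (circEquiv τ σ) (tmul S (symRep S _ a) (symRep S _ b))) :=
  rfl

theorem circTree_smul {τ σ : Tr} (c : ℝ) (a : HatTree S τ) (b : HatTree S σ) :
    circTree S (c • a) b = c • circTree S a b := by
  simp only [circTree_eq, map_smul, tmul_smul_left]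

theorem circTree_zero_left {τ σ : Tr} (b : HatTree S σ) :
    circTree S (0 : HatTree S τ) b = 0 := by
  simpa using circTree_smul S 0 (0 : HatTree S τ) b

theorem circTree_zero_right {τ σ : Tr} (a : HatTree S τ) :
    circTree S a (0 : HatTree S σ) = 0 := by
  have h := tmul_smul_right S 0 (symRep S _ a) (0 : HatPower S σ.1)
  rw [zero_smul, zero_smul] at h
  simp only [circTree_eq, map_zero, h]

theorem circ_smul_left (c : ℝ) (x y : HatTr S) : circ S (c • x) y = c • circ S x y := by
  funext ρ
  simp only [circ, Pi.smul_apply, Finset.smul_sum, circTree_smul, Pi.single_smul]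

theorem circ_zero_left (y : HatTr S) : circ S 0 y = 0 := by
  simpa using circ_smul_left S 0 0 y

/-- The number of root children is additive under `∘`, and the right factor always contributes one.
-/
theorem circ_proj_proj_one (k : ℕ) (x y : HatTr S) :
    circ S (proj S k x) (proj S 1 y) = proj S (k + 1) (circ S x (proj S 1 y)) := by
  funext ρ
  have key : ∀ τ σ : Tr, Pi.single (M := HatTree S) (τ.circ σ)
      (circTree S (proj S k x τ) (proj S 1 y σ)) ρ =
      if ρ.numRootChildren = k + 1 then Pi.single (M := HatTree S) (τ.circ σ)
        (circTree S (x τ) (proj S 1 y σ)) ρ else 0 := by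
    intro τ σ
    by_cases hρ : ρ = τ.circ σ
    · subst hρ
      by_cases hσ : σ.numRootChildren = 1
      · simp only [numRootChildren_circ, hσ, Nat.add_right_cancel_iff, Pi.single_eq_same]
        by_cases hτ : τ.numRootChildren = k
        · simp [proj, hτ]
        · simp [proj, hτ, circTree_zero_left]
      · simp [proj, hσ, circTree_zero_right]
    · simp [Pi.single_eq_of_ne hρ]
  simp only [circ, proj] at key ⊢
  simp only [key]
  split_ifs <;> simp

/-- Evaluates `id * π₁` on `t` in two ways: by counting root children, and by substituting `t ⊗ t`
for the coproduct. -/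
theorem numRootChildren_smul_of_coprodGL_eq {t : HatTr S} (ht : coprodGL S t = tensor S t t)
    (ρ : Tr) : ρ.numRootChildren • t ρ = circ S t (proj S 1 t) ρ := by
  rw [← convolution_id_proj_one, circ]
  refine Finset.sum_congr rfl fun d _ => Finset.sum_congr rfl fun τ _ =>
    Finset.sum_congr rfl fun σ _ => ?_
  rw [ht, circTree₂_tensor]
  congr 1
  simp only [proj]
  split_ifs
  · rfl
  · rw [circTree_zero_right]

theorem succ_smul_proj_succ {t : HatTr S} (ht : coprodGL S t = tensor S t t) (k : ℕ) :
    ((k + 1 : ℕ) : ℝ) • proj S (k + 1) t = circ S (proj S k t) (proj S 1 t) := by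
  rw [circ_proj_proj_one]
  funext ρ
  simp only [proj, Pi.smul_apply]
  split_ifs with h
  · rw [← numRootChildren_smul_of_coprodGL_eq S ht, h, Nat.cast_smul_eq_nsmul]
  · rw [smul_zero]

theorem proj_succ_eq {t : HatTr S} (ht : coprodGL S t = tensor S t t) (k : ℕ) :
    proj S (k + 1) t = ((k + 1 : ℕ) : ℝ)⁻¹ • circ S (proj S k t) (proj S 1 t) := by
  rw [← succ_smul_proj_succ S ht, smul_smul, inv_mul_cancel₀ (by positivity), one_smul]

theorem proj_eq_circPow {t : HatTr S} (ht : coprodGL S t = tensor S t t)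
    (h₀ : proj S 0 t = unit S) (k : ℕ) :
    proj S k t = ((k.factorial : ℝ)⁻¹) • circPow S (proj S 1 t) k := by
  induction k with
  | zero => simp [h₀, circPow]
  | succ k ih =>
    rw [proj_succ_eq S ht, ih, circ_smul_left, smul_smul, circPow, Nat.factorial_succ,
      Nat.cast_mul, mul_inv]

theorem proj_apply_self (x : HatTr S) (ρ : Tr) : proj S ρ.numRootChildren x ρ = x ρ :=
  if_pos rfl

/-- The recursion propagates the vanishing of `π₀ t` to every `π_k t`. It serves to exclude a zero
scalar part. -/
theorem eq_zero_of_proj_zero {t : HatTr S} (ht : coprodGL S t = tensor S t t)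
    (h₀ : proj S 0 t = 0) : t = 0 := by
  have h : ∀ k, proj S k t = 0 := by
    intro k
    cases k with
    | zero => exact h₀
    | succ k =>
      induction k with
      | zero => rw [proj_succ_eq S ht, h₀, circ_zero_left, smul_zero]
      | succ k ih => rw [proj_succ_eq S ht, ih, circ_zero_left, smul_zero]
  funext ρ
  rw [← proj_apply_self S t ρ, h]

theorem proj_zero_eq_single (x : HatTr S) :
    proj S 0 x = Pi.single (M := HatTree S) Tr.one (x Tr.one) := by
  funext ρ
  by_cases h : ρ = Tr.one
  · subst h
    rw [proj, if_pos ((Tr.numRootChildren_eq_zero _).2 rfl), Pi.single_eq_same]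
  · rw [proj, if_neg fun h' => h ((Tr.numRootChildren_eq_zero _).1 h'), Pi.single_eq_of_ne h]

theorem cls_scalarOne_injective {n : ℕ} (h : n = 0) (G : Subgroup (Equiv.Perm (Fin n)))
    {a b : ℝ} (hab : cls S G (a • scalarOne S n h) = cls S G (b • scalarOne S n h)) :
    a • scalarOne S n h = b • scalarOne S n h := by
  have := congrArg (symRep S G) hab
  simpa only [symRep_cls, map_smul, sym_scalarOne] using this

/-- Only `I = ∅` occurs, and both resulting factors are trivial trees. Degrees vanish only
propositionally because these factors are `branches ∅` and `coBranches ∅`, not `Tr.one` itself. -/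
theorem coprodTree_scalarOne {τ : Tr} (hτ : τ.1 = 0) (c : ℝ) (q : Tr × Tr)
    (hq : q.1.1 + q.2.1 = 0) :
    coprodTree S (cls S τ.rep.SG (c • scalarOne S τ.1 hτ)) q =
      cls S (SG₂ q.1 q.2) (c • scalarOne S _ hq) := by
  have hempty : τ.rep.rootChildren = ∅ :=
    Finset.eq_empty_of_forall_notMem fun v => (Fin.cast hτ (τ.rep.enum.symm v)).elim0
  have hdeg := EnumTree.card_branches_add τ.rep ∅
  have h₁ : (τ.rep.branches ∅).1 = 0 := by omega
  have h₂ : (τ.rep.coBranches ∅).1 = 0 := by omega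
  have h₃ : q.1.1 = 0 := by omega
  have h₄ : q.2.1 = 0 := by omega
  obtain rfl : q = (τ.rep.branches ∅, τ.rep.coBranches ∅) :=
    Prod.ext ((Tr.eq_one_of_degree h₃).trans (Tr.eq_one_of_degree h₁).symm)
      ((Tr.eq_one_of_degree h₄).trans (Tr.eq_one_of_degree h₂).symm)
  rw [coprodTree, hempty, Finset.powerset_empty, Finset.sum_singleton, Pi.single_eq_same,
    symRep_cls, map_smul, sym_scalarOne, map_smul, relabel_scalarOne S hτ (hdeg.trans hτ)]

theorem coprodGL_one_one (x : HatTr S) (c : ℝ)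
    (hx : x Tr.one = cls S Tr.one.rep.SG (c • scalarOne S Tr.one.1 Tr.one_degree)) :
    coprodGL S x (Tr.one, Tr.one) =
      cls S (SG₂ Tr.one Tr.one) (c • scalarOne S (Tr.one.1 + Tr.one.1) Tr.one_degree_add) := by
  rw [coprodGL_apply S (n := 0) x _ rfl, Fintype.sum_unique]
  change coprodTree S (x Tr.one) _ = _
  rw [hx]
  exact coprodTree_scalarOne S (τ := Tr.one) Tr.one_degree c (Tr.one, Tr.one) Tr.one_degree_add

theorem proj_zero_of_isGroupLike {t : HatTr S} (ht : IsGroupLike S t) :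
    proj S 0 t = unit S := by
  obtain ⟨hne, ht⟩ := ht
  obtain ⟨z, hz⟩ := exists_cls S (t Tr.one)
  obtain ⟨c, rfl⟩ := exists_eq_smul_scalarOne S Tr.one_degree z
  have hc : c • scalarOne S Tr.one.1 Tr.one_degree ≠ 0 := fun h => hne <| eq_zero_of_proj_zero S ht <| by
    rw [proj_zero_eq_single, ← hz, h, map_zero, Pi.single_zero]
  have h := congrFun ht (Tr.one, Tr.one)
  have h₁ : tensor S t t (Tr.one, Tr.one) = cls S (SG₂ Tr.one Tr.one)
      (tmul S (symRep S _ (t Tr.one)) (symRep S _ (t Tr.one))) := rfl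
  rw [coprodGL_one_one S t c hz.symm, h₁] at h
  have hsym : symRep S _ (t Tr.one) = c • scalarOne S Tr.one.1 Tr.one_degree := by
    rw [← hz, symRep_cls, map_smul, sym_scalarOne]
  rw [hsym, tmul_smul_left, tmul_smul_right, tmul_scalarOne S _ _ Tr.one_degree_add,
    smul_smul] at h
  have h' := cls_scalarOne_injective S Tr.one_degree_add _ h
  have hc1 : c = 1 := by
    -- The degrees `0 + 0` and `0` agree by definition, so `h'` is read as an equation in `V^{⊗̂
    -- 0}`.
    have hcc : (c - c * c) • scalarOne S Tr.one.1 Tr.one_degree = 0 := by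
      rw [sub_smul]
      exact sub_eq_zero.2 h'
    rcases smul_eq_zero.1 hcc with h0 | h0
    · have : c ≠ 0 := fun h => hc (by rw [h, zero_smul])
      have : c * (1 - c) = 0 := by linarith
      grind
    · exact absurd (by rw [h0, smul_zero]) hc
  rw [proj_zero_eq_single, ← hz, hc1, one_smul, unit]
  exact congrArg (fun v => Pi.single (M := HatTree S) Tr.one (cls S Tr.one.rep.SG
    (TPower.toHat S 0 (PiTensorProduct.tprod ℝ v)))) (Subsingleton.elim _ _)

/-- At each tree only one `k` gives a nonzero summand, so convergence in the product topology is
immediate. -/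
theorem hasSum_proj (x : HatTr S) : HasSum (fun k => proj S k x) x := by
  rw [Pi.hasSum]
  intro ρ
  convert hasSum_ite_eq ρ.numRootChildren (x ρ) using 2 with k
  simp only [proj, eq_comm]

end Exponential

end LabelledTrees

end

theorem mainTheorem4 {V : Type*} [AddCommGroup V] [Module ℝ V] [TopologicalSpace V]
    [IsTopologicalAddGroup V] [ContinuousSMul ℝ V] [LocallyConvexSpace ℝ V] {ι : Type*}
    (S : LabelledTrees.SymmetricCrossSystem V ι) (t : LabelledTrees.HatTr S)
    (ht : LabelledTrees.IsGroupLike S t) :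
    HasSum (fun k : ℕ =>
        ((k.factorial : ℝ)⁻¹) • LabelledTrees.circPow S (LabelledTrees.proj S 1 t) k) t ∧
      t = LabelledTrees.expCirc S (LabelledTrees.proj S 1 t) := by
  have h := LabelledTrees.hasSum_proj S t
  rw [funext (LabelledTrees.proj_eq_circPow S ht.2
    (LabelledTrees.proj_zero_of_isGroupLike S ht))] at h
  exact ⟨h, h.tsum_eq.symm⟩
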